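/- Let $d\ge 2$ and let $\mathcal S=\{|\psi_1\rangle,\dots,|\psi_{d^2}\rangle\}$ be an orthonormal basis of $\mathbb C^d\otimes\mathbb C^d$ consisting of maximally entangled states, i.e. each $|\psi_i\rangle=(U_i\otimes \mathbb I)|\Gamma\rangle$ with $U_i$ unitary and $|\Gamma\rangle=\frac1{\sqrt d}\sum_{j=1}^d|jj\rangle$. Then $\mathcal S$ is $(d^2,2)$-unidentifiable: two distinct states drawn from $\mathcal S$ and shared between Alice and Bob cannot, in general, be perfectly identified by LOCC. Precisely, for every two-element subset $s=\{p,q\}\subset\{1,\dots,d^2\}$ let $$\rho_s=\tfrac12\,|\psi_p\rangle\langle\psi_p|_{A_1B_1}\otimes|\psi_q\rangle\langle\psi_q|_{A_2B_2}+\tfrac12\,|\psi_q\rangle\langle\psi_q|_{A_1B_1}\otimes|\psi_p\rangle\langle\psi_p|_{A_2B_2},$$ a state shared by Alice (who holds $A_1A_2$, with space $\mathbb C^{d^2}$) and Bob (who holds $B_1B_2$, with space $\mathbb C^{d^2}$). Then there is no LOCC measurement $(E_s)_s$, with outcomes the two-element subsets $s$, such that $\operatorname{Tr}(\rho_sE_s)=1$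 for every $s$. Here an LOCC measurement is one implemented by a sequence of rounds, in each of which one party performs a local quantum measurement with finitely many outcomes (possibly changing its finite local dimension) that may depend on all earlier outcomes, and announces its outcome. The number of rounds may be infinite; in that case the measurement is the limit of the POVMs of finite-round protocols, each of which continues the previous one. -/

import Mathlib

open scoped Matrix Kronecker

namespace LocalSubset

/-- A finite-round LOCC protocol for Alice (local space `ℂ^a`) and Bob (local space `ℂ^b`) that ends
with an output in `X`. In each round one party performs a quantum measurement on its own system, with
Kraus operators `K i` satisfying `∑ i, (K i)ᴴ * K i = 1`; the local dimension may change, so local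
ancillas and discarding are covered. The outcome `i` is broadcast, and the rest of the protocol may
depend on it. (A local instrument with several Kraus operators per outcome, local randomness and shared
randomness are obtained by ignoring part of the outcome.) -/
inductive Protocol (X : Type) : ℕ → ℕ → Type
  | output {a b : ℕ} (x : X) : Protocol X a b
  | alice {a b m : ℕ} (a' : Fin m → ℕ) (K : ∀ i, Matrix (Fin (a' i)) (Fin a) ℂ)
      (hK : ∑ i, (K i)ᴴ * K i = 1) (next : ∀ i, Protocol X (a' i) b) : Protocol X a b
  | bob {a b m : ℕ} (b' : Fin m → ℕ) (K : ∀ i, Matrix (Fin (b' i)) (Fin b) ℂ)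
      (hK : ∑ i, (K i)ᴴ * K i = 1) (next : ∀ i, Protocol X a (b' i)) : Protocol X a b

/-- The POVM on `ℂ^a ⊗ ℂ^b` implemented by a finite-round protocol: on a state `ρ`, the output is `x`
with probability `Tr (ρ * T.povm x)`. -/
noncomputable def Protocol.povm {X : Type} [DecidableEq X] :
    {a b : ℕ} → Protocol X a b → X → Matrix (Fin a × Fin b) (Fin a × Fin b) ℂ
  | _, _, .output y, x => if x = y then 1 else 0
  | _, b, .alice _ K _ next, x =>
      ∑ i, (K i ⊗ₖ (1 : Matrix (Fin b) (Fin b) ℂ))ᴴ * (next i).povm x *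
        (K i ⊗ₖ (1 : Matrix (Fin b) (Fin b) ℂ))
  | a, _, .bob _ K _ next, x =>
      ∑ i, ((1 : Matrix (Fin a) (Fin a) ℂ) ⊗ₖ K i)ᴴ * (next i).povm x *
        ((1 : Matrix (Fin a) (Fin a) ℂ) ⊗ₖ K i)

/-- `Extends T T'`: the protocol `T'` first runs `T` and then possibly continues with further rounds
(which may revise the provisional output of `T`). -/
inductive Protocol.Extends {X : Type} : {a b : ℕ} → Protocol X a b → Protocol X a b → Prop
  | output {a b : ℕ} (x : X) (T : Protocol X a b) : Extends (.output x) T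
  | alice {a b m : ℕ} (a' : Fin m → ℕ) (K : ∀ i, Matrix (Fin (a' i)) (Fin a) ℂ)
      (hK : ∑ i, (K i)ᴴ * K i = 1) (next next' : ∀ i, Protocol X (a' i) b)
      (h : ∀ i, Extends (next i) (next' i)) : Extends (.alice a' K hK next) (.alice a' K hK next')
  | bob {a b m : ℕ} (b' : Fin m → ℕ) (K : ∀ i, Matrix (Fin (b' i)) (Fin b) ℂ)
      (hK : ∑ i, (K i)ᴴ * K i = 1) (next next' : ∀ i, Protocol X a (b' i))
      (h : ∀ i, Extends (next i) (next' i)) : Extends (.bob b' K hK next) (.bob b' K hK next')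

/-- A measurement on `ℂ^a ⊗ ℂ^b` is LOCC if it is implemented by a possibly infinite-round protocol:
a sequence of finite-round protocols, each continuing the previous one, whose POVMs converge to it.
A constant sequence gives the finite-round measurements. -/
def IsLOCC {X : Type} [DecidableEq X] {a b : ℕ}
    (E : X → Matrix (Fin a × Fin b) (Fin a × Fin b) ℂ) : Prop :=
  ∃ T : ℕ → Protocol X a b, (∀ t, (T t).Extends (T (t + 1))) ∧
    ∀ x, Filter.Tendsto (fun t => (T t).povm x) Filter.atTop (nhds (E x))

/-- The vector `φ 0 ⊗ ⋯ ⊗ φ (k - 1)` of `k` bipartite pure states in `ℂ^d ⊗ ℂ^d`, seen as a bipartite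
vector in `ℂ^(d^k) ⊗ ℂ^(d^k)`: Alice holds all the first factors and Bob all the second ones. The
basis of `ℂ^(d^k) = (ℂ^d)^{⊗k}` is labelled through the standard bijection `(Fin k → Fin d) ≃ Fin (d^k)`. -/
noncomputable def sharedVector {d k : ℕ} (φ : Fin k → EuclideanSpace ℂ (Fin d × Fin d)) :
    Fin (d ^ k) × Fin (d ^ k) → ℂ :=
  fun p => ∏ j, φ j (finFunctionFinEquiv.symm p.1 j, finFunctionFinEquiv.symm p.2 j)

/-- The state shared when the `k`-element subset `{ψ i | i ∈ s}` is distributed without revealing the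
identities or the order of its elements: the equal mixture of the products over all orderings of `s`. -/
noncomputable def subsetState {d n : ℕ} (k : ℕ) (ψ : Fin n → EuclideanSpace ℂ (Fin d × Fin d))
    (s : Finset (Fin n)) : Matrix (Fin (d ^ k) × Fin (d ^ k)) (Fin (d ^ k) × Fin (d ^ k)) ℂ :=
  (1 / (k.factorial : ℂ)) • ∑ σ : Fin k ≃ s,
    Matrix.vecMulVec (sharedVector fun j => ψ (σ j)) (star (sharedVector fun j => ψ (σ j)))

/-- `(n, k)`-identifiability of the states `ψ 0, …, ψ (n - 1)` in `ℂ^d ⊗ ℂ^d`: some LOCC measurement,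
whose outcomes are the `k`-element subsets, names the distributed subset with probability one,
whichever `k`-element subset it is. -/
def IsLocallyIdentifiable {d n : ℕ} (ψ : Fin n → EuclideanSpace ℂ (Fin d × Fin d)) (k : ℕ) : Prop :=
  ∃ E : {s : Finset (Fin n) // s.card = k} →
      Matrix (Fin (d ^ k) × Fin (d ^ k)) (Fin (d ^ k) × Fin (d ^ k)) ℂ,
    IsLOCC E ∧
      ∀ s : {s : Finset (Fin n) // s.card = k}, (subsetState k ψ s.1 * E s).trace = 1

/-- The standard maximally entangled vector `Γ = d^(-1/2) ∑ j, |j j⟩` in `ℂ^d ⊗ ℂ^d`. -/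
noncomputable def Gam (d : ℕ) : Fin d × Fin d → ℂ :=
  fun p => if p.1 = p.2 then ((1 / Real.sqrt d : ℝ) : ℂ) else 0

/-- A vector in `ℂ^d ⊗ ℂ^d` is a maximally entangled state if it is `(U ⊗ 1) Γ` for a unitary `U`. -/
def IsMaximallyEntangled {d : ℕ} (ψ : EuclideanSpace ℂ (Fin d × Fin d)) : Prop :=
  ∃ U ∈ Matrix.unitaryGroup (Fin d) ℂ,
    ψ = WithLp.toLp 2 ((U ⊗ₖ (1 : Matrix (Fin d) (Fin d) ℂ)) *ᵥ Gam d)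

end LocalSubset

namespace LocalSubset

open Matrix Filter
open scoped ComplexOrder MatrixOrder

/-! Every effect of a finite-round protocol is separable, and a separable operator `M` on `ℂ^D ⊗
ℂ^D` has expectation at most `Tr M / D` in a maximally entangled state
(`re_expectation_le_of_mem_separableCone`). Both sides are continuous in `M`, so the bound survives
infinitely many rounds. Products of maximally entangled states are maximally entangled with `D = d ^
k`, so an effect that names its subset with certainty has trace at least `d ^ k`
(`IsLOCC.pow_le_re_trace`). The effects sum to the identity, of trace `d ^ 4` for `k = 2`; hence `(d
^ 2).choose 2 * d ^ 2 ≤ d ^ 4`, which fails once `d ^ 2 ≥ 4`. -/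

/-- The cone of separable operators on `ℂ^a ⊗ ℂ^b`: sums of tensor products of positive semidefinite
matrices. -/
def separableCone (m n : Type*) [Fintype m] [Fintype n] :
    AddSubmonoid (Matrix (m × n) (m × n) ℂ) :=
  AddSubmonoid.closure {M | ∃ A B, A.PosSemidef ∧ B.PosSemidef ∧ M = A ⊗ₖ B}

theorem conj_kronecker_mem_separableCone {m n m' n' : Type*} [Fintype m] [Fintype n] [Fintype m']
    [Fintype n'] {M : Matrix (m × n) (m × n) ℂ} (hM : M ∈ separableCone m n)
    (K : Matrix m m' ℂ) (L : Matrix n n' ℂ) :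
    (K ⊗ₖ L)ᴴ * M * (K ⊗ₖ L) ∈ separableCone m' n' := by
  induction hM using AddSubmonoid.closure_induction with
  | mem M h =>
    obtain ⟨A, B, hA, hB, rfl⟩ := h
    refine AddSubmonoid.subset_closure ⟨Kᴴ * A * K, Lᴴ * B * L,
      hA.conjTranspose_mul_mul_same K, hB.conjTranspose_mul_mul_same L, ?_⟩
    rw [conjTranspose_kronecker, mul_kronecker_mul, mul_kronecker_mul]
  | zero => simp
  | add M N _ _ hM hN => rw [Matrix.mul_add, Matrix.add_mul]; exact add_mem hM hN

/-- An output contributes `0` or `1 ⊗ 1`, and each earlier round only conjugates by a local Kraus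
operator and sums over outcomes. -/
theorem Protocol.povm_mem_separableCone {X : Type} [DecidableEq X] {a b : ℕ} (T : Protocol X a b)
    (x : X) : T.povm x ∈ separableCone (Fin a) (Fin b) := by
  induction T with
  | output y =>
    rw [Protocol.povm]
    split_ifs
    · exact AddSubmonoid.subset_closure
        ⟨1, 1, PosSemidef.one, PosSemidef.one, one_kronecker_one.symm⟩
    · exact zero_mem _
  | alice a' K hK next ih =>
    rw [Protocol.povm]
    exact sum_mem fun i _ => conj_kronecker_mem_separableCone (ih i) _ _
  | bob b' K hK next ih =>
    rw [Protocol.povm]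
    exact sum_mem fun i _ => conj_kronecker_mem_separableCone (ih i) _ _

theorem Protocol.sum_povm {X : Type} [DecidableEq X] [Fintype X] {a b : ℕ} (T : Protocol X a b) :
    ∑ x, T.povm x = 1 := by
  induction T with
  | output y => simp [Protocol.povm]
  | alice a' K hK next ih =>
    simp only [Protocol.povm]
    rw [Finset.sum_comm]
    simp_rw [← Matrix.sum_mul, ← Matrix.mul_sum, ih, Matrix.mul_one, conjTranspose_kronecker,
      ← mul_kronecker_mul, conjTranspose_one, Matrix.mul_one]
    rw [← one_kronecker_one, ← hK]
    ext ⟨i, j⟩ ⟨i', j'⟩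
    simp [Matrix.sum_apply, Finset.sum_mul]
  | bob b' K hK next ih =>
    simp only [Protocol.povm]
    rw [Finset.sum_comm]
    simp_rw [← Matrix.sum_mul, ← Matrix.mul_sum, ih, Matrix.mul_one, conjTranspose_kronecker,
      ← mul_kronecker_mul, conjTranspose_one, Matrix.mul_one]
    rw [← one_kronecker_one, ← hK]
    ext ⟨i, j⟩ ⟨i', j'⟩
    simp [Matrix.sum_apply, Finset.mul_sum]

theorem re_trace_conjTranspose_mul_self {m n : Type*} [Fintype m] [Fintype n]
    (A : Matrix m n ℂ) : (Aᴴ * A).trace.re = ∑ i, ∑ j, ‖A i j‖ ^ 2 := by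
  rw [Finset.sum_comm]
  simp only [trace, diag_apply, mul_apply, conjTranspose_apply, Complex.re_sum]
  refine Finset.sum_congr rfl fun j _ => Finset.sum_congr rfl fun i _ => ?_
  rw [Complex.star_def, Complex.conj_mul', ← Complex.ofReal_pow, Complex.ofReal_re]

/-- The trace of a product of positive semidefinite matrices is at most the product of traces. -/
theorem re_trace_mul_le {n : Type*} [Fintype n] {A B : Matrix n n ℂ}
    (hA : A.PosSemidef) (hB : B.PosSemidef) :
    (A * B).trace.re ≤ A.trace.re * B.trace.re := by
  classical
  obtain ⟨P, rfl⟩ := CStarAlgebra.nonneg_iff_eq_star_mul_self.1 hA.nonneg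
  obtain ⟨Q, rfl⟩ := CStarAlgebra.nonneg_iff_eq_star_mul_self.1 hB.nonneg
  simp only [star_eq_conjTranspose]
  -- By cyclicity the trace is the squared Frobenius norm of `P * Qᴴ`; Cauchy–Schwarz on each entry
  -- then gives submultiplicativity.
  have h : (Pᴴ * P * (Qᴴ * Q)).trace = ((P * Qᴴ)ᴴ * (P * Qᴴ)).trace := by
    rw [conjTranspose_mul, conjTranspose_conjTranspose, ← Matrix.mul_assoc, trace_mul_comm]
    simp only [Matrix.mul_assoc]
  rw [h, re_trace_conjTranspose_mul_self, re_trace_conjTranspose_mul_self,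
    re_trace_conjTranspose_mul_self, Finset.sum_mul_sum]
  refine Finset.sum_le_sum fun i _ => Finset.sum_le_sum fun j _ => ?_
  rw [mul_apply]
  calc ‖∑ k, P i k * Qᴴ k j‖ ^ 2 ≤ (∑ k, ‖P i k‖ * ‖Q j k‖) ^ 2 := by
        gcongr
        refine (norm_sum_le _ _).trans_eq (Finset.sum_congr rfl fun k _ => ?_)
        rw [norm_mul, conjTranspose_apply, norm_star]
    _ ≤ _ := Finset.sum_mul_sq_le_sq_mul_sq _ _ _

/-- A separable operator has overlap at most `Tr M / D` with a maximally entangled state, here given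
by its coefficient matrix `V`. -/
theorem re_expectation_le_of_mem_separableCone {n : Type*} [Fintype n] [DecidableEq n]
    {M : Matrix (n × n) (n × n) ℂ} (hM : M ∈ separableCone n n) {V : Matrix n n ℂ} {c : ℝ}
    (hV : V * Vᴴ = (c : ℂ) • 1) :
    (star (fun p : n × n => V p.1 p.2) ⬝ᵥ M *ᵥ fun p => V p.1 p.2).re ≤ c * M.trace.re := by
  induction hM using AddSubmonoid.closure_induction with
  | mem M h =>
    obtain ⟨A, B, hA, hB, rfl⟩ := h
    -- Vectorization: `A ⊗ B` acts on the coefficient matrix as `V ↦ A * V * Bᵀ`.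
    have h1 : (star (fun p : n × n => V p.1 p.2) ⬝ᵥ (A ⊗ₖ B) *ᵥ fun p => V p.1 p.2)
        = (Vᴴ * A * V * Bᵀ).trace := by
      have : (A ⊗ₖ B) *ᵥ (fun p => V p.1 p.2) = fun p => (A * V * Bᵀ) p.1 p.2 := by
        ext ⟨i, j⟩
        simp only [mulVec, dotProduct, mul_apply, kroneckerMap_apply, transpose_apply,
          Fintype.sum_prod_type, Finset.sum_mul]
        rw [Finset.sum_comm]
        exact Finset.sum_congr rfl fun _ _ => Finset.sum_congr rfl fun _ _ => by ring
      rw [this, Matrix.mul_assoc Vᴴ, Matrix.mul_assoc Vᴴ]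
      simp only [dotProduct, Fintype.sum_prod_type, trace, diag_apply, Pi.star_apply]
      rw [Finset.sum_comm]
      rfl
    have h2 : (Vᴴ * A * V).trace = c * A.trace := by
      rw [trace_mul_comm, ← Matrix.mul_assoc, hV, smul_mul, Matrix.one_mul, trace_smul,
        smul_eq_mul]
    have h3 := re_trace_mul_le (hA.conjTranspose_mul_mul_same V) hB.transpose
    rw [h2, trace_transpose, Complex.re_ofReal_mul] at h3
    have h4 : A.trace.im = 0 := (Complex.nonneg_iff.1 hA.trace_nonneg).2.symm
    rw [h1, trace_kronecker, Complex.mul_re, h4, zero_mul, sub_zero, ← mul_assoc]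
    exact h3
  | zero => simp
  | add M N _ _ hM hN =>
    rw [add_mulVec, dotProduct_add, trace_add, Complex.add_re, Complex.add_re, mul_add]
    exact add_le_add hM hN

/-- The bound is a closed condition on the effect, so it passes to the limit without showing that
the separable cone is closed. -/
theorem IsLOCC.re_expectation_le {X : Type} [DecidableEq X] {n : ℕ}
    {E : X → Matrix (Fin n × Fin n) (Fin n × Fin n) ℂ} (hE : IsLOCC E) (x : X)
    {V : Matrix (Fin n) (Fin n) ℂ} {c : ℝ} (hV : V * Vᴴ = (c : ℂ) • 1) :
    (star (fun p : Fin n × Fin n => V p.1 p.2) ⬝ᵥ E x *ᵥ fun p => V p.1 p.2).re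
      ≤ c * (E x).trace.re := by
  obtain ⟨T, -, hT⟩ := hE
  refine le_of_tendsto_of_tendsto' (b := atTop)
    (f := fun t => (star (fun p : Fin n × Fin n => V p.1 p.2) ⬝ᵥ (T t).povm x *ᵥ
      fun p => V p.1 p.2).re) (g := fun t => c * ((T t).povm x).trace.re) ?_ ?_
    fun t => re_expectation_le_of_mem_separableCone ((T t).povm_mem_separableCone x) hV
  · have h : Continuous fun M : Matrix (Fin n × Fin n) (Fin n × Fin n) ℂ => (star (fun p : Fin n × Fin n => V p.1 p.2) ⬝ᵥ M *ᵥ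
      fun p => V p.1 p.2).re := by
      fun_prop
    exact (h.tendsto (E x)).comp (hT x)
  · have h : Continuous fun M : Matrix (Fin n × Fin n) (Fin n × Fin n) ℂ => c * M.trace.re := by
      fun_prop
    exact (h.tendsto (E x)).comp (hT x)

theorem IsLOCC.sum_eq_one {X : Type} [DecidableEq X] [Fintype X] {a b : ℕ}
    {E : X → Matrix (Fin a × Fin b) (Fin a × Fin b) ℂ} (hE : IsLOCC E) : ∑ x, E x = 1 := by
  obtain ⟨T, -, hT⟩ := hE
  refine tendsto_nhds_unique (tendsto_finsetSum _ fun x _ => hT x) ?_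
  simp_rw [Protocol.sum_povm]
  exact tendsto_const_nhds

theorem IsMaximallyEntangled.sum_mul_star {d : ℕ} {φ : EuclideanSpace ℂ (Fin d × Fin d)}
    (hφ : IsMaximallyEntangled φ) (i i' : Fin d) :
    ∑ j, φ (i, j) * star (φ (i', j)) = if i = i' then (d : ℂ)⁻¹ else 0 := by
  obtain ⟨U, hU, rfl⟩ := hφ
  have h : ∀ i j, ((U ⊗ₖ (1 : Matrix (Fin d) (Fin d) ℂ)) *ᵥ Gam d) (i, j)
      = U i j * ((1 / Real.sqrt d : ℝ) : ℂ) := by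
    intro i j
    simp only [mulVec, dotProduct, Fintype.sum_prod_type, kroneckerMap_apply, Gam, one_apply]
    simp
  have hs : ((1 / Real.sqrt d : ℝ) : ℂ) * ((1 / Real.sqrt d : ℝ) : ℂ) = (d : ℂ)⁻¹ := by
    rw [← Complex.ofReal_mul, div_mul_div_comm, Real.mul_self_sqrt d.cast_nonneg]
    simp
  have hU' := congrFun (congrFun (mem_unitaryGroup_iff.1 hU) i) i'
  rw [star_eq_conjTranspose, mul_apply, one_apply] at hU'
  simp only [h, star_mul', Complex.star_def, Complex.conj_ofReal]
  calc _ = (∑ j, U i j * Uᴴ j i') * (d : ℂ)⁻¹ := by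
        rw [← hs, Finset.sum_mul]
        exact Finset.sum_congr rfl fun j _ => by
          rw [conjTranspose_apply, Complex.star_def]; ring
    _ = _ := by rw [hU', ite_mul, one_mul, zero_mul]

/-- A product of maximally entangled states is maximally entangled across the Alice–Bob cut. -/
theorem sharedVector_mul_conjTranspose {d k : ℕ} {φ : Fin k → EuclideanSpace ℂ (Fin d × Fin d)}
    (hφ : ∀ j, IsMaximallyEntangled (φ j)) :
    (of fun i j => sharedVector φ (i, j)) * (of fun i j => sharedVector φ (i, j))ᴴ
      = ((((d : ℝ) ^ k)⁻¹ : ℝ) : ℂ) • 1 := by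
  ext i i'
  simp only [mul_apply, conjTranspose_apply, of_apply, sharedVector, star_prod,
    ← Finset.prod_mul_distrib]
  -- Bob's index runs over all tuples, so the sum of products factors into one sum per copy.
  rw [finFunctionFinEquiv.symm.sum_comp fun f : Fin k → Fin d => ∏ x,
    (φ x (finFunctionFinEquiv.symm i x, f x) * star (φ x (finFunctionFinEquiv.symm i' x, f x))),
    ← Fintype.prod_sum fun x j =>
      φ x (finFunctionFinEquiv.symm i x, j) * star (φ x (finFunctionFinEquiv.symm i' x, j))]
  simp only [(hφ _).sum_mul_star]
  rw [Matrix.smul_apply, one_apply, smul_eq_mul]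
  split_ifs with h
  · subst h; simp
  · rw [mul_zero]
    obtain ⟨x, hx⟩ := Function.ne_iff.1 (finFunctionFinEquiv.symm.injective.ne h)
    exact Finset.prod_eq_zero (Finset.mem_univ x) (if_neg hx)

/-- An LOCC effect that detects a subset state of maximally entangled states with certainty has trace
at least the local dimension. -/
theorem IsLOCC.pow_le_re_trace {X : Type} [DecidableEq X] {d n k : ℕ} (hd : d ≠ 0)
    {E : X → Matrix (Fin (d ^ k) × Fin (d ^ k)) (Fin (d ^ k) × Fin (d ^ k)) ℂ} (hE : IsLOCC E)
    {ψ : Fin n → EuclideanSpace ℂ (Fin d × Fin d)} (hψ : ∀ i, IsMaximallyEntangled (ψ i))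
    {s : Finset (Fin n)} (hs : s.card = k) {x : X} (hx : (subsetState k ψ s * E x).trace = 1) :
    (d : ℝ) ^ k ≤ (E x).trace.re := by
  have hcard : Fintype.card (Fin k ≃ s) = k.factorial := by
    rw [Fintype.card_equiv (s.equivFinOfCardEq hs).symm, Fintype.card_fin]
  have h1 := congrArg Complex.re hx
  simp only [subsetState, smul_mul, trace_smul, Finset.sum_mul, trace_sum, smul_eq_mul,
    Complex.one_re] at h1
  rw [show (1 / (k.factorial : ℂ)) = ((1 / (k.factorial : ℝ) : ℝ) : ℂ) by push_cast; rfl,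
    Complex.re_ofReal_mul, Complex.re_sum] at h1
  -- Every ordering obeys the same bound, hence so does their average; the `k!` orderings cancel the
  -- normalization.
  have h2 : ∀ σ : Fin k ≃ s, (vecMulVec (sharedVector fun j => ψ (σ j))
      (star (sharedVector fun j => ψ (σ j))) * E x).trace.re
        ≤ ((d : ℝ) ^ k)⁻¹ * (E x).trace.re := by
    intro σ
    rw [vecMulVec_mul, trace_vecMulVec, dotProduct_comm, ← dotProduct_mulVec]
    exact hE.re_expectation_le x (sharedVector_mul_conjTranspose fun j => hψ (σ j))
  have h3 := Finset.sum_le_sum fun σ (_ : σ ∈ Finset.univ) => h2 σ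
  rw [Finset.sum_const, Finset.card_univ, hcard, nsmul_eq_mul] at h3
  have hk : (0 : ℝ) < k.factorial := by exact_mod_cast k.factorial_pos
  have hd' : (0 : ℝ) < (d : ℝ) ^ k := by positivity
  rw [one_div, inv_mul_eq_one₀ hk.ne'] at h1
  rw [← h1, le_mul_iff_one_le_right hk, inv_mul_eq_div, one_le_div hd'] at h3
  exact h3

end LocalSubset

theorem mainTheorem6 (d : ℕ) (hd : 2 ≤ d)
    (ψ : OrthonormalBasis (Fin (d ^ 2)) ℂ (EuclideanSpace ℂ (Fin d × Fin d)))
    (hψ : ∀ i, LocalSubset.IsMaximallyEntangled (ψ i)) :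
    ¬ LocalSubset.IsLocallyIdentifiable (fun i => ψ i) 2 := by
  rintro ⟨E, hE, hs⟩
  have h1 := Finset.sum_le_sum fun s (_ : s ∈ Finset.univ) =>
    hE.pow_le_re_trace (by omega) hψ s.2 (hs s)
  rw [← Complex.re_sum, ← Matrix.trace_sum, hE.sum_eq_one, Finset.sum_const, Finset.card_univ,
    Fintype.card_finset_len, Fintype.card_fin, Matrix.trace_one, Fintype.card_prod,
    Fintype.card_fin, Complex.natCast_re, nsmul_eq_mul] at h1
  -- One trace bound per two-element subset, against the trace of the identity.
  have h2 : (d ^ 2).choose 2 * d ^ 2 ≤ d ^ 2 * d ^ 2 := by exact_mod_cast h1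
  have h3 : (d ^ 2).choose 2 ≤ d ^ 2 := Nat.le_of_mul_le_mul_right h2 (by positivity)
  have h4 : 4 ≤ d ^ 2 := by nlinarith
  generalize d ^ 2 = n at h3 h4
  obtain ⟨m, rfl⟩ := Nat.exists_eq_add_of_le' h4
  -- Floor division leaves `n * (n - 1) ≤ 2 * n + 1`, still false for every `n ≥ 4`.
  rw [Nat.choose_two_right, Nat.div_le_iff_le_mul_add_pred (by norm_num)] at h3
  simp only [Nat.add_succ_sub_one] at h3
  nlinarith
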